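/- All triangles lie in the Euclidean plane and are nondegenerate; a triangle is isosceles if at least two of its sides are equal. For a triangle $ABC$ let $A_1\in BC$, $B_1\in CA$, $C_1\in AB$ be the points where its internal angle bisectors meet the opposite sides; $A_1B_1C_1$ is the bisectral triangle of $ABC$. A Sharygin triangle is a non-isosceles triangle whose bisectral triangle is isosceles. (1) If the three vertices of a Sharygin triangle are vertices of some regular polygon, then the triangle is similar to the heptagonal triangle, that is, the triangle with angles $\pi/7$, $2\pi/7$, $4\pi/7$. (2) Up to an isometry of the plane, there is exactly one Sharygin triangle whose vertices are chosen from the vertices of a regular polygon (with any number $n\ge 3$ of vertices) inscribed in a circle of radius $1$. -/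

import Mathlib

open scoped EuclideanGeometry Real

/-- Among the three distances between the points `A`, `B`, `C`, at least two are equal. -/
def IsIsosceles (A B C : ℂ) : Prop :=
  dist A B = dist A C ∨ dist B A = dist B C ∨ dist C A = dist C B

/-- `P` is the point at which the internal bisector of the angle `BAC` meets the side `BC`. -/
def IsBisectorFoot (A B C P : ℂ) : Prop :=
  P ∈ segment ℝ B C ∧ ∠ B A P = ∠ P A C

/-- A Sharygin triangle: a (nondegenerate) non-isosceles triangle in the Euclidean plane `ℂ` whose
bisectral triangle `A₁B₁C₁` is isosceles. -/
def IsSharygin (T : Affine.Triangle ℝ ℂ) : Prop :=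
  ¬ IsIsosceles (T.points 0) (T.points 1) (T.points 2) ∧
  ∃ A₁ B₁ C₁ : ℂ,
    IsBisectorFoot (T.points 0) (T.points 1) (T.points 2) A₁ ∧
    IsBisectorFoot (T.points 1) (T.points 2) (T.points 0) B₁ ∧
    IsBisectorFoot (T.points 2) (T.points 0) (T.points 1) C₁ ∧
    IsIsosceles A₁ B₁ C₁

/-- A heptagonal triangle: its angles are `π/7`, `2π/7`, `4π/7`, in this order. -/
def IsHeptagonal (T : Affine.Triangle ℝ ℂ) : Prop :=
  ∠ (T.points 2) (T.points 0) (T.points 1) = π / 7 ∧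
  ∠ (T.points 0) (T.points 1) (T.points 2) = 2 * π / 7 ∧
  ∠ (T.points 1) (T.points 2) (T.points 0) = 4 * π / 7

/-- `V` is the vertex set of a regular polygon inscribed in a circle of radius `r`: it consists of
`n ≥ 3` points, equally spaced on a circle with center `c`; the point `c + w` is one of them. -/
def IsRegularPolygonVertexSet (r : ℝ) (V : Set ℂ) : Prop :=
  0 < r ∧ ∃ (n : ℕ) (c w : ℂ), 3 ≤ n ∧ ‖w‖ = r ∧
    V = Set.range fun k : Fin n =>
      c + w * Complex.exp (2 * (π : ℂ) * Complex.I * ((k : ℕ) : ℂ) / (n : ℂ))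

/-- The vertices of `T` are vertices of a regular polygon inscribed in a circle of radius `r`. -/
def HasVerticesInRegularPolygon (r : ℝ) (T : Affine.Triangle ℝ ℂ) : Prop :=
  ∃ V : Set ℂ, IsRegularPolygonVertexSet r V ∧ Set.range T.points ⊆ V

/-!
Let `α`, `β`, `γ` be the angles of a scalene triangle `ABC`. Comparing the side lengths, the
distances from `C₁` to `A₁` and `B₁` are equal if and only if
`2 * cos γ * (sin α + sin β + sin γ) + sin γ = 0`. In terms of `s = (α + β) / 2` and
`d = (α - β) / 2` this reads `cos (3 * s) + cos (2 * s + d) + cos (2 * s - d) = 0`.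

By the inscribed angle theorem, the angles are rational multiples of `π` when the vertices belong to
a regular polygon, so the latter equation is a vanishing sum of six roots of unity. By Mann's
theorem, if no proper subsum vanishes, then the quotients of the terms have order dividing
`2 * 3 * 5`, which makes `30 * s` an integer multiple of `π`; otherwise a cosine vanishes or two
triples of terms form equilateral triangles. As `π / 5 < s < 2 * π / 9`, only
`s = 3 * π / 14`, `d = π / 14` survives: the heptagonal triangle. Its similarity class and the
circumradius determine a triangle up to isometry.
-/

section Mann

open Finset ZMod

theorem sum_pow_mul_eq_zero_of_coprime {ι K : Type*} [Fintype ι] [CommRing K] [IsDomain K]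
    [CharZero K] {N k : ℕ} {ζ : K} (hζ : IsPrimitiveRoot ζ N) (hN : 0 < N) (hk : k.Coprime N)
    {a : ι → ℕ} (h : ∑ i, ζ ^ a i = 0) : ∑ i, ζ ^ (k * a i) = 0 := by
  have hdvd : minpoly ℤ ζ ∣ ∑ i, Polynomial.X ^ a i :=
    minpoly.isIntegrallyClosed_dvd (hζ.isIntegral hN) (by simpa using h)
  rw [hζ.minpoly_eq_pow_coprime hk] at hdvd
  simpa [pow_mul] using Polynomial.aeval_eq_zero_of_dvd_aeval_eq_zero hdvd (minpoly.aeval ℤ _)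

theorem eq_zero_of_dft_eq_zero_of_ne {N : ℕ} [NeZero N] {E : Type*} [AddCommGroup E] [Module ℂ E]
    {f : ZMod N → E} {k₀ r : ZMod N} (hf : ∀ k ≠ k₀, dft f k = 0) (hr : f r = 0) : f = 0 := by
  have hk₀ : dft f k₀ = 0 := by
    have hinv := congrFun (dft.symm_apply_apply f) r
    rw [invDFT_apply, Fintype.sum_eq_single k₀ fun k hk => by rw [hf k hk, smul_zero], hr] at hinv
    simpa [NeZero.ne N, stdAddChar_coe, stdAddChar_apply] using hinv
  refine (map_eq_zero_iff dft dft.injective).1 (funext fun k => ?_)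
  by_cases hk : k = k₀
  · rw [hk, hk₀, Pi.zero_apply]
  · exact hf k hk

/-- The part of the sum `∑ i, ζ ^ a i` carried by the exponents congruent to `r` modulo `p`. As a
function of `r` its discrete Fourier transform consists of Galois conjugates of the whole sum. -/
noncomputable def residueSum {ι : Type*} [Fintype ι] (p : ℕ) (ζ : ℂ) (a : ι → ℕ) (r : ZMod p) : ℂ :=
  ∑ i with (a i : ZMod p) = r, ζ ^ a i

variable {ι : Type*} [Fintype ι] {p M : ℕ} {ζ : ℂ} {a : ι → ℕ}

theorem dft_residueSum [NeZero p] (hζM : ζ ^ M = stdAddChar (1 : ZMod p)) (j : ℕ) :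
    dft (residueSum p ζ a) (-j) = ∑ i, ζ ^ ((1 + j * M) * a i) := by
  have hchar (i : ι) : stdAddChar ((a i : ZMod p) * (j : ZMod p)) = ζ ^ (j * M * a i) := by
    rw [← Nat.cast_mul, ← nsmul_one, AddChar.map_nsmul_eq_pow, ← hζM, ← pow_mul]
    ring_nf
  simp only [dft_apply, residueSum, smul_eq_mul, mul_sum, mul_neg, neg_neg]
  rw [← sum_fiberwise univ (fun i => (a i : ZMod p)) fun i => ζ ^ ((1 + j * M) * a i)]
  refine sum_congr rfl fun r _ => sum_congr rfl fun i hi => ?_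
  rw [← (mem_filter.1 hi).2, hchar, add_mul, one_mul, pow_add, mul_comm]

variable [Fact p.Prime]

theorem dft_residueSum_eq_zero (hζ : IsPrimitiveRoot ζ (p * M)) (hM : 0 < M)
    (hζM : ζ ^ M = stdAddChar (1 : ZMod p)) (h : ∑ i, ζ ^ a i = 0) {k : ZMod p} (hk : k * M ≠ 1) :
    dft (residueSum p ζ a) k = 0 := by
  obtain ⟨j, hj⟩ := natCast_zmod_surjective (-k)
  have hp : p.Prime := Fact.out
  have hpj : ¬ p ∣ 1 + j * M := by
    rw [← natCast_eq_zero_iff]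
    push_cast
    rw [hj, neg_mul, ← sub_eq_add_neg, sub_eq_zero]
    exact hk.symm
  have hcop : (1 + j * M).Coprime (p * M) :=
    (((Nat.Prime.coprime_iff_not_dvd hp).2 hpj).symm).mul_right (by simp)
  rw [← neg_neg k, ← hj, dft_residueSum hζM]
  exact sum_pow_mul_eq_zero_of_coprime hζ (Nat.mul_pos hp.pos hM) hcop h

theorem residueSum_eq_zero (hζ : IsPrimitiveRoot ζ (p * M)) (hM : 0 < M)
    (hζM : ζ ^ M = stdAddChar (1 : ZMod p)) (h : ∑ i, ζ ^ a i = 0)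
    (hp : p ∣ M ∨ Fintype.card ι < p) : residueSum p ζ a = 0 := by
  rcases hp with hpM | hcard
  · refine (map_eq_zero_iff dft dft.injective).1 (funext fun k => ?_)
    refine dft_residueSum_eq_zero hζ hM hζM h ?_
    rw [(natCast_eq_zero_iff M p).2 hpM, mul_zero]
    exact zero_ne_one
  · obtain ⟨r, hr⟩ : ∃ r : ZMod p, ∀ i, (a i : ZMod p) ≠ r := by
      by_contra! hsurj
      have := Fintype.card_le_of_surjective (fun i => (a i : ZMod p)) hsurj
      rw [ZMod.card] at this
      omega
    refine eq_zero_of_dft_eq_zero_of_ne (k₀ := (M : ZMod p)⁻¹) (r := r) (fun k hk => ?_) ?_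
    · exact dft_residueSum_eq_zero hζ hM hζM h fun h1 => hk (eq_inv_of_mul_eq_one_left h1)
    · exact sum_eq_zero fun i hi => absurd (mem_filter.1 hi).2 (hr i)

/-- A vanishing sum none of whose nonempty proper subsums vanishes. -/
def IsMinimalVanishingSum {ι K : Type*} [Fintype ι] [AddCommMonoid K] (z : ι → K) : Prop :=
  ∑ i, z i = 0 ∧ ∀ T : Finset ι, T.Nonempty → ∑ i ∈ T, z i = 0 → T = univ

namespace IsMinimalVanishingSum

theorem div_pow_div_prime_eq_one {z : ι → ℂ} (hz : IsMinimalVanishingSum z) {N : ℕ} (hN : 0 < N)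
    (hzN : ∀ i j, (z i / z j) ^ N = 1) (hpN : p ∣ N) (hp : p ∣ N / p ∨ Fintype.card ι < p)
    (i j : ι) : (z i / z j) ^ (N / p) = 1 := by
  obtain ⟨M, rfl⟩ := hpN
  have hpp : p.Prime := Fact.out
  have hpM : NeZero (p * M) := ⟨hN.ne'⟩
  have hM : 0 < M := pos_of_mul_pos_right hN p.zero_le
  rw [Nat.mul_div_cancel_left _ hpp.pos] at hp ⊢
  set ζ := Complex.exp (2 * π * Complex.I / (p * M : ℕ)) with hζdef
  have hζ : IsPrimitiveRoot ζ (p * M) := Complex.isPrimitiveRoot_exp _ hN.ne'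
  have hζM : ζ ^ M = stdAddChar (1 : ZMod p) := by
    rw [← Int.cast_one, stdAddChar_coe, hζdef, ← Complex.exp_nat_mul]
    congr 1
    have hM0 : (M : ℂ) ≠ 0 := Nat.cast_ne_zero.2 hM.ne'
    push_cast
    field_simp
  choose a ha using fun i => (hζ.eq_pow_of_pow_eq_one (hzN i j))
  have hzj : z j ≠ 0 := fun h0 => by simpa [h0, hN.ne'] using hzN j j
  have hsum (T : Finset ι) : ∑ i ∈ T, ζ ^ a i = (∑ i ∈ T, z i) / z j := by
    simp only [(ha _).2, sum_div]
  have hres := congrFun (residueSum_eq_zero (a := a) hζ hM hζM (by rw [hsum, hz.1, zero_div]) hp) 0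
  have haj : a j = 0 := by
    by_contra hne
    refine hζ.pow_ne_one_of_pos_of_lt hne (ha j).1 ?_
    rw [(ha j).2, div_self hzj]
  have huniv : ({i | (a i : ZMod p) = 0} : Finset ι) = univ := by
    refine hz.2 _ ⟨j, by simp [haj]⟩ ?_
    rw [residueSum, hsum, Pi.zero_apply] at hres
    exact (div_eq_zero_iff.1 hres).resolve_right hzj
  obtain ⟨b, hb⟩ : p ∣ a i := by
    rw [← natCast_eq_zero_iff]
    simpa using huniv.ge (mem_univ i)
  rw [← (ha i).2, hb, ← pow_mul, mul_right_comm, pow_mul, hζ.pow_eq_one, one_pow]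

theorem div_pow_primorial_eq_one {z : ι → ℂ} (hz : IsMinimalVanishingSum z)
    (hfin : ∀ i, IsOfFinOrder (z i)) (i j : ι) :
    (z i / z j) ^ primorial (Fintype.card ι) = 1 := by
  have hex : ∃ N, 0 < N ∧ ∀ i j, (z i / z j) ^ N = 1 := by
    refine ⟨∏ i, orderOf (z i), prod_pos fun i _ => (hfin i).orderOf_pos, fun i j => ?_⟩
    have hpow (i : ι) : z i ^ ∏ i, orderOf (z i) = 1 :=
      orderOf_dvd_iff_pow_eq_one.1 (dvd_prod_of_mem _ (mem_univ i))
    rw [div_pow, hpow, hpow, div_one]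
  classical
  set N := Nat.find hex
  obtain ⟨hN, hzN⟩ : 0 < N ∧ ∀ i j, (z i / z j) ^ N = 1 := Nat.find_spec hex
  have hreduced {p : ℕ} (hp : p.Prime) (hpN : p ∣ N) : ¬ (p ∣ N / p ∨ Fintype.card ι < p) := by
    intro hcase
    have := Fact.mk hp
    exact Nat.find_min hex (Nat.div_lt_self hN hp.one_lt)
      ⟨Nat.div_pos (Nat.le_of_dvd hN hpN) hp.pos, hz.div_pow_div_prime_eq_one hN hzN hpN hcase⟩
  have hsq : Squarefree N := by
    refine Nat.squarefree_iff_prime_squarefree.2 fun p hp hppN => ?_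
    exact hreduced hp (dvd_of_mul_left_dvd hppN) (Or.inl (Nat.dvd_div_of_mul_dvd hppN))
  have hdvd : N ∣ primorial (Fintype.card ι) := by
    rw [← Nat.prod_primeFactors_of_squarefree hsq]
    refine prod_dvd_prod_of_subset _ _ _ fun p hp => ?_
    have hpp := Nat.prime_of_mem_primeFactors hp
    have hle := not_lt.1 (not_or.1 (hreduced hpp (Nat.dvd_of_mem_primeFactors hp))).2
    exact mem_filter.2 ⟨mem_range.2 (Nat.lt_succ_of_le hle), hpp⟩
  exact orderOf_dvd_iff_pow_eq_one.1 ((orderOf_dvd_of_pow_eq_one (hzN i j)).trans hdvd)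

end IsMinimalVanishingSum

end Mann

section VanishingSumOfCosines

open Finset

theorem exists_sum_eq_zero_of_not_isMinimalVanishingSum {ι K : Type*} [Fintype ι]
    [AddCommGroup K] {z : ι → K} (h : ∑ i, z i = 0) (hz : ¬ IsMinimalVanishingSum z) :
    ∃ T : Finset ι, T.Nonempty ∧ 2 * T.card ≤ Fintype.card ι ∧ ∑ i ∈ T, z i = 0 := by
  classical
  obtain ⟨T, hT, hsum, huniv⟩ :
      ∃ T : Finset ι, T.Nonempty ∧ ∑ i ∈ T, z i = 0 ∧ T ≠ univ := by
    simpa [IsMinimalVanishingSum, h] using hz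
  have hcompl := sum_add_sum_compl T z
  have hcard := card_add_card_compl T
  rw [hsum, h, zero_add] at hcompl
  rcases le_total T.card Tᶜ.card with hle | hle
  · exact ⟨T, hT, by omega, hsum⟩
  · exact ⟨Tᶜ, (compl_ne_univ_iff_nonempty Tᶜ).1 (by rwa [compl_compl]), by omega, hcompl⟩

theorem pow_three_eq_prod_of_sum_eq_zero {ι : Type*} {T : Finset ι} {z : ι → ℂ}
    (hz : ∀ i, ‖z i‖ = 1) (hT : T.card = 3) (h : ∑ i ∈ T, z i = 0) {i : ι} (hi : i ∈ T) :
    z i ^ 3 = ∏ j ∈ T, z j := by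
  classical
  obtain ⟨a, b, c, hab, hac, hbc, rfl⟩ := card_eq_three.1 hT
  have hsum : z a + z b + z c = 0 := by simpa [hab, hac, hbc, add_assoc] using h
  have hconj (j : ι) : z j * (starRingEnd ℂ) (z j) = 1 := by
    rw [Complex.mul_conj']; simp [hz]
  have hpair : z a * z b + z b * z c + z c * z a = 0 := by
    have hsum' := congrArg (starRingEnd ℂ) hsum
    simp only [map_add, map_zero] at hsum'
    linear_combination z a * z b * z c * hsum' - z b * z c * hconj a - z a * z c * hconj b
      - z a * z b * hconj c
  rw [prod_insert (by simp [hab, hac]), prod_pair hbc]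
  simp only [mem_insert, mem_singleton] at hi
  rcases hi with rfl | rfl | rfl
  · linear_combination z i ^ 2 * hsum - z i * hpair
  · linear_combination z i ^ 2 * hsum - z i * hpair
  · linear_combination z i ^ 2 * hsum - z i * hpair

variable {x : Fin 3 → ℂ}

theorem sum_elim_inv_eq_zero (hx : ∀ k, ‖x k‖ = 1) (h : ∑ k, (x k).re = 0) :
    ∑ i, Sum.elim x x⁻¹ i = 0 := by
  have hinv (k : Fin 3) : x k + (x k)⁻¹ = (2 * (x k).re : ℝ) := by
    rw [Complex.inv_eq_conj (hx k), Complex.add_conj]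
  simp only [Fintype.sum_sum_type, Sum.elim_inl, Sum.elim_inr, Pi.inv_apply, ← sum_add_distrib,
    hinv]
  rw [← Complex.ofReal_sum, ← mul_sum, h, mul_zero, Complex.ofReal_zero]

theorem exists_re_eq_zero_of_card_le_two (hx : ∀ k, ‖x k‖ = 1) (h : ∑ k, (x k).re = 0)
    {T : Finset (Fin 3 ⊕ Fin 3)} (hT : T.Nonempty) (hcard : T.card ≤ 2)
    (hsum : ∑ i ∈ T, Sum.elim x x⁻¹ i = 0) : ∃ k, (x k).re = 0 := by
  have hre (i : Fin 3 ⊕ Fin 3) : (Sum.elim x x⁻¹ i).re = (x (Sum.elim id id i)).re := by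
    rcases i with k | k
    · rfl
    · simp [Complex.inv_eq_conj (hx k)]
  have hsum' : ∑ i ∈ T, (x (Sum.elim id id i)).re = 0 := by
    simpa [hre] using congrArg Complex.re hsum
  have hpos := hT.card_pos
  obtain h1 | h2 : T.card = 1 ∨ T.card = 2 := by omega
  · obtain ⟨i, rfl⟩ := card_eq_one.1 h1
    exact ⟨_, by simpa using hsum'⟩
  · obtain ⟨i, j, hij, rfl⟩ := card_eq_two.1 h2
    rw [sum_pair hij] at hsum'
    generalize Sum.elim id id i = k, Sum.elim id id j = l at hsum'
    by_contra! hne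
    -- If two of the three real parts are opposite, the third one vanishes.
    rw [Fin.sum_univ_three] at h
    have := hne 0
    have := hne 1
    have := hne 2
    fin_cases k <;> fin_cases l <;> grind

theorem re_pow_three_eq_of_card_eq_three (hx : ∀ k, ‖x k‖ = 1) (h : ∑ k, (x k).re = 0)
    {T : Finset (Fin 3 ⊕ Fin 3)} (hcard : T.card = 3)
    (hsum : ∑ i ∈ T, Sum.elim x x⁻¹ i = 0) (k l : Fin 3) : (x k ^ 3).re = (x l ^ 3).re := by
  set z : Fin 3 ⊕ Fin 3 → ℂ := Sum.elim x x⁻¹ with hz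
  have hnorm : ∀ i, ‖z i‖ = 1 := Sum.rec hx fun k => by simp [hz, hx k]
  have hcompl : ∑ i ∈ Tᶜ, z i = 0 := by
    rw [← sum_elim_inv_eq_zero hx h, ← sum_add_sum_compl T, hsum, zero_add]
  have hcube (i) (hi : i ∈ T) : z i ^ 3 = ∏ j ∈ T, z j :=
    pow_three_eq_prod_of_sum_eq_zero hnorm hcard hsum hi
  have hcube' (i) (hi : i ∉ T) : z i ^ 3 = ∏ j ∈ Tᶜ, z j :=
    pow_three_eq_prod_of_sum_eq_zero hnorm (by rw [card_compl, hcard]; rfl) hcompl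
      (mem_compl.2 hi)
  -- `T` has odd size, so it is not a union of pairs `{z, z⁻¹}`.
  obtain ⟨m, hm⟩ : ∃ m, ¬ (Sum.inl m ∈ T ↔ Sum.inr m ∈ T) := by
    by_contra! hall
    have hleft : T.toLeft = T.toRight := by ext m; simpa using hall m
    have := T.card_toLeft_add_card_toRight
    rw [hleft] at this
    omega
  have hre : (∏ j ∈ T, z j).re = (∏ j ∈ Tᶜ, z j).re := by
    have hinv : (z (Sum.inl m) ^ 3).re = (z (Sum.inr m) ^ 3).re := by
      simp [hz, Complex.inv_eq_conj (hx m), ← map_pow, Complex.conj_re, -inv_pow]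
    by_cases hl : Sum.inl m ∈ T
    · rwa [hcube _ hl, hcube' _ fun hr => hm (iff_of_true hl hr)] at hinv
    · rw [hcube' _ hl, hcube _ (by tauto)] at hinv
      exact hinv.symm
  have hconst (k : Fin 3) : (x k ^ 3).re = (∏ j ∈ T, z j).re := by
    by_cases hk : Sum.inl k ∈ T
    · rw [← hcube _ hk, hz, Sum.elim_inl]
    · rw [hre, ← hcube' _ hk, hz, Sum.elim_inl]
  rw [hconst k, hconst l]

theorem re_eq_zero_or_re_pow_three_eq_or_pow_thirty_eq_one (hx : ∀ k, IsOfFinOrder (x k))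
    (h : ∑ k, (x k).re = 0) :
    (∃ k, (x k).re = 0) ∨ (∀ k l, (x k ^ 3).re = (x l ^ 3).re) ∨ ∀ k l, (x k * x l) ^ 30 = 1 := by
  have hnorm (k : Fin 3) : ‖x k‖ = 1 := (hx k).norm_eq_one
  have hsum := sum_elim_inv_eq_zero hnorm h
  by_cases hmin : IsMinimalVanishingSum (Sum.elim x x⁻¹)
  · have hfin : ∀ i, IsOfFinOrder (Sum.elim x x⁻¹ i) :=
      Sum.rec hx fun k => by
        obtain ⟨n, hn, hxn⟩ := isOfFinOrder_iff_pow_eq_one.1 (hx k)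
        exact isOfFinOrder_iff_pow_eq_one.2 ⟨n, hn, by simp [hxn]⟩
    refine Or.inr (Or.inr fun k l => ?_)
    have h30 : primorial 6 = 30 := by decide
    simpa [h30] using hmin.div_pow_primorial_eq_one hfin (Sum.inl k) (Sum.inr l)
  · obtain ⟨T, hT, hcard, hTsum⟩ := exists_sum_eq_zero_of_not_isMinimalVanishingSum hsum hmin
    rw [Fintype.card_sum, Fintype.card_fin] at hcard
    rcases (show T.card ≤ 2 ∨ T.card = 3 by omega) with hle | heq
    · exact Or.inl (exists_re_eq_zero_of_card_le_two hnorm h hT hle hTsum)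
    · exact Or.inr (Or.inl (re_pow_three_eq_of_card_eq_three hnorm h heq hTsum))

end VanishingSumOfCosines

section RationalAngles

open Real

theorem isOfFinOrder_exp_of_eq_rat_mul_pi {θ : ℝ} (h : ∃ q : ℚ, θ = q * π) :
    IsOfFinOrder (Complex.exp (θ * Complex.I)) := by
  obtain ⟨q, rfl⟩ := h
  refine isOfFinOrder_iff_pow_eq_one.2 ⟨2 * q.den, by have := q.den_pos; omega, ?_⟩
  push_cast
  exact Complex.exp_rat_mul_pi_mul_I_pow_two_mul_den q

theorem cos_eq_zero_or_cos_three_mul_eq_or_of_sum_cos_eq_zero {θ : Fin 3 → ℝ}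
    (hθ : ∀ k, ∃ q : ℚ, θ k = q * π) (h : ∑ k, cos (θ k) = 0) :
    (∃ k, cos (θ k) = 0) ∨ (∀ k l, cos (3 * θ k) = cos (3 * θ l)) ∨
      ∀ k l, ∃ n : ℤ, 15 * (θ k + θ l) = n * π := by
  have hcube (k : Fin 3) : (Complex.exp (θ k * Complex.I) ^ 3).re = cos (3 * θ k) := by
    rw [← Complex.exp_nat_mul, ← Complex.exp_ofReal_mul_I_re]
    push_cast
    ring_nf
  rcases re_eq_zero_or_re_pow_three_eq_or_pow_thirty_eq_one
      (fun k => isOfFinOrder_exp_of_eq_rat_mul_pi (hθ k))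
      (by simpa [Complex.exp_ofReal_mul_I_re] using h) with ⟨k, hk⟩ | hpow | hpow
  · exact Or.inl ⟨k, by rwa [Complex.exp_ofReal_mul_I_re] at hk⟩
  · exact Or.inr (Or.inl fun k l => by rw [← hcube, ← hcube, hpow k l])
  · refine Or.inr (Or.inr fun k l => ?_)
    have hkl := hpow k l
    rw [← Complex.exp_add, ← Complex.exp_nat_mul, Complex.exp_eq_one_iff] at hkl
    obtain ⟨n, hn⟩ := hkl
    refine ⟨n, ?_⟩
    have hcast : ((15 * (θ k + θ l) : ℝ) : ℂ) = (n * π : ℝ) := by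
      push_cast at hn ⊢
      linear_combination -Complex.I / 2 * hn + (15 * (θ k + θ l) - n * π) * Complex.I_sq
    exact_mod_cast hcast

theorem two_mul_cos_mul_add_sin_eq {α β γ : ℝ} (h : α + β + γ = π) :
    2 * cos γ * (sin α + sin β + sin γ) + sin γ =
      -(2 * sin ((α + β) / 2)) * (cos (3 * ((α + β) / 2)) + cos (2 * ((α + β) / 2) + (α - β) / 2) +
        cos (2 * ((α + β) / 2) - (α - β) / 2)) := by
  obtain ⟨s, hs⟩ : ∃ s, s = (α + β) / 2 := ⟨_, rfl⟩
  obtain ⟨d, hd⟩ : ∃ d, d = (α - β) / 2 := ⟨_, rfl⟩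
  rw [← hs, ← hd]
  obtain rfl : α = s + d := by linarith
  obtain rfl : β = s - d := by linarith
  obtain rfl : γ = π - 2 * s := by linarith
  rw [cos_pi_sub, sin_pi_sub, sin_add, sin_sub, cos_add, cos_sub, cos_three_mul, sin_two_mul,
    cos_two_mul]
  ring

theorem bounds_of_cubic_eq_zero {c e : ℝ} (hc : 0 < c) (hce : c < e) (he : e < 1)
    (h : 4 * c ^ 3 - 3 * c + 2 * (2 * c ^ 2 - 1) * e = 0) : 0.78 < c ∧ c ^ 2 < 0.625 := by
  have hpos : 0 < 2 * c ^ 2 - 1 := by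
    by_contra! hcon
    nlinarith [mul_nonneg (sub_nonneg.2 hcon) (sub_nonneg.2 hce.le)]
  have hupper : c * (8 * c ^ 2 - 5) < 0 := by
    linarith [mul_pos hpos (sub_pos.2 hce)]
  have hlower : 0 < (2 * c + 1) * (2 * c ^ 2 + c - 2) := by
    linarith [mul_pos hpos (sub_pos.2 he)]
  have hlower' := pos_of_mul_pos_right hlower (by positivity)
  have hupper' := neg_of_mul_neg_right hupper hc.le
  exact ⟨by nlinarith, by linarith⟩

variable {s d : ℝ}

theorem bounds_of_sum_cos_eq_zero (hd : 0 < d) (hds : d < s) (hs : s < π / 2)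
    (h : cos (3 * s) + cos (2 * s + d) + cos (2 * s - d) = 0) : π / 5 < s ∧ s < 2 * π / 9 := by
  have hc : 0 < cos s := cos_pos_of_mem_Ioo ⟨by linarith, hs⟩
  have hce : cos s < cos d := cos_lt_cos_of_nonneg_of_le_pi hd.le (by linarith) hds
  have he : cos d < 1 := cos_zero ▸ cos_lt_cos_of_nonneg_of_le_pi le_rfl (by linarith) hd
  obtain ⟨hlower, hupper⟩ := bounds_of_cubic_eq_zero hc hce he (by
    rw [cos_add, cos_sub, cos_three_mul, cos_two_mul] at h
    linarith)
  have hs₃ : s < π / 3 := by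
    by_contra! hcon
    have := cos_le_cos_of_nonneg_of_le_pi (by positivity) (by linarith) hcon
    rw [cos_pi_div_three] at this
    linarith
  constructor
  · by_contra! hcon
    have hle := cos_le_cos_of_nonneg_of_le_pi (by linarith) (by linarith) hcon
    have hsqrt : 2.2 < √5 := lt_sqrt (by norm_num) |>.2 (by norm_num)
    rw [cos_pi_div_five] at hle
    nlinarith
  · by_contra! hcon
    have hle : cos (3 * s) ≤ cos (π - π / 3) :=
      cos_le_cos_of_nonneg_of_le_pi (by linarith) (by linarith) (by linarith)
    rw [cos_pi_sub, cos_pi_div_three, cos_three_mul] at hle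
    nlinarith [mul_pos (sub_pos.2 hlower) (sub_pos.2 hlower)]

theorem eq_of_sum_cos_eq_zero_of_cos_eq_zero (hs₁ : π / 5 < s) (hs₂ : s < 2 * π / 9) (hd : 0 < d)
    (hds : d < s) (h : cos (3 * s) + cos (2 * s + d) + cos (2 * s - d) = 0)
    (hzero : cos (3 * s) = 0 ∨ cos (2 * s + d) = 0 ∨ cos (2 * s - d) = 0) :
    s = 3 * π / 14 ∧ d = π / 14 := by
  rw [← cos_pi_div_two] at hzero
  rcases hzero with h0 | h0 | h0
  · have := injOn_cos ⟨by linarith, by linarith⟩ ⟨by linarith, by linarith⟩ h0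
    linarith
  · have hsum := injOn_cos ⟨by linarith, by linarith⟩ ⟨by linarith, by linarith⟩ h0
    have hdiff : 3 * s = π - (2 * s - d) := by
      refine injOn_cos ⟨by linarith, by linarith⟩ ⟨by linarith, by linarith⟩ ?_
      rw [cos_pi_sub]
      rw [cos_pi_div_two] at h0
      linarith
    exact ⟨by linarith, by linarith⟩
  · have := injOn_cos ⟨by linarith, by linarith⟩ ⟨by linarith, by linarith⟩ h0
    linarith

theorem eq_of_sum_cos_eq_zero (hsπ : ∃ q : ℚ, s = q * π) (hdπ : ∃ q : ℚ, d = q * π) (hd : 0 < d)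
    (hds : d < s) (hs : s < π / 2) (h : cos (3 * s) + cos (2 * s + d) + cos (2 * s - d) = 0) :
    s = 3 * π / 14 ∧ d = π / 14 := by
  obtain ⟨hs₁, hs₂⟩ := bounds_of_sum_cos_eq_zero hd hds hs h
  have hrat : ∀ k, ∃ q : ℚ, ![3 * s, 2 * s + d, 2 * s - d] k = q * π := by
    obtain ⟨q, rfl⟩ := hsπ
    obtain ⟨r, rfl⟩ := hdπ
    refine Fin.forall_fin_succ.2
      ⟨⟨3 * q, ?_⟩, Fin.forall_fin_two.2 ⟨⟨2 * q + r, ?_⟩, 2 * q - r, ?_⟩⟩ <;>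
    · simp
      ring
  rcases cos_eq_zero_or_cos_three_mul_eq_or_of_sum_cos_eq_zero hrat
      (by simpa [Fin.sum_univ_three] using h) with hzero | hthree | hperiod
  · exact eq_of_sum_cos_eq_zero_of_cos_eq_zero hs₁ hs₂ hd hds h
      (by simpa [Fin.exists_fin_succ] using hzero)
  · have hcos : cos (2 * π - 3 * (3 * s)) = cos (2 * π - 3 * (2 * s + d)) := by
      rw [cos_two_pi_sub, cos_two_pi_sub]
      exact hthree 0 1
    have := injOn_cos ⟨by linarith, by linarith⟩ ⟨by linarith, by linarith⟩ hcos
    linarith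
  · obtain ⟨m, hm⟩ : ∃ m : ℤ, 15 * (3 * s + 3 * s) = m * π := hperiod 0 0
    obtain ⟨n, hn⟩ : ∃ n : ℤ, 15 * (2 * s + d + (2 * s - d)) = n * π := hperiod 1 2
    have hmn : 30 * s = (m - n : ℤ) * π := by push_cast; linarith
    have hgt : (6 : ℝ) < (m - n : ℤ) := by nlinarith [pi_pos]
    have hlt : ((m - n : ℤ) : ℝ) < 7 := by nlinarith [pi_pos]
    norm_cast at hgt hlt
    omega

theorem angles_eq_of_rational {α β γ : ℝ} (hα : 0 < α) (hβ : 0 < β) (hγ : 0 < γ)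
    (hsum : α + β + γ = π) (hne : α ≠ β) (h : 2 * cos γ * (sin α + sin β + sin γ) + sin γ = 0)
    (hαπ : ∃ q : ℚ, α = q * π) (hβπ : ∃ q : ℚ, β = q * π) :
    γ = 4 * π / 7 ∧ ((α = π / 7 ∧ β = 2 * π / 7) ∨ (α = 2 * π / 7 ∧ β = π / 7)) := by
  wlog hlt : β < α generalizing α β
  · obtain ⟨hγ', hαβ⟩ := this hβ hα (by linarith) hne.symm (by linarith) hβπ hαπ
      (lt_of_le_of_ne (not_lt.1 hlt) hne)
    exact ⟨hγ', by tauto⟩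
  have hrat (ε : ℚ) : ∃ q : ℚ, (α + ε * β) / 2 = q * π := by
    obtain ⟨q, rfl⟩ := hαπ
    obtain ⟨r, rfl⟩ := hβπ
    exact ⟨(q + ε * r) / 2, by push_cast; ring⟩
  have hsin : 0 < sin ((α + β) / 2) := sin_pos_of_pos_of_lt_pi (by linarith) (by linarith)
  rw [two_mul_cos_mul_add_sin_eq hsum] at h
  obtain ⟨hs, hd⟩ := eq_of_sum_cos_eq_zero (by simpa using hrat 1)
    (by simpa [← sub_eq_add_neg] using hrat (-1)) (by linarith) (by linarith) (by linarith)
    ((mul_eq_zero.1 h).resolve_left (by linarith))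
  exact ⟨by linarith, Or.inr ⟨by linarith, by linarith⟩⟩

end RationalAngles

section AngleBisector

open InnerProductGeometry

theorem angle_smul_add_smul_eq_iff {V : Type*} [NormedAddCommGroup V] [InnerProductSpace ℝ V]
    {x y : V} {a b : ℝ} (hx : x ≠ 0) (hy : y ≠ 0) (hxy : angle x y ≠ 0)
    (hab : a • x + b • y ≠ 0) :
    angle x (a • x + b • y) = angle (a • x + b • y) y ↔ a * ‖x‖ = b * ‖y‖ := by
  have hinner : ‖x‖ * ‖y‖ - inner ℝ x y ≠ 0 :=
    sub_ne_zero.2 fun h => hxy ((inner_eq_mul_norm_iff_angle_eq_zero hx hy).1 h.symm)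
  have hfactor : inner ℝ x (a • x + b • y) * (‖a • x + b • y‖ * ‖y‖) -
      inner ℝ (a • x + b • y) y * (‖x‖ * ‖a • x + b • y‖) =
      ‖a • x + b • y‖ * (‖x‖ * ‖y‖ - inner ℝ x y) * (a * ‖x‖ - b * ‖y‖) := by
    simp only [inner_add_left, inner_add_right, real_inner_smul_left, real_inner_smul_right,
      real_inner_self_eq_norm_sq]
    ring
  rw [← Real.injOn_cos.eq_iff ⟨angle_nonneg _ _, angle_le_pi _ _⟩
      ⟨angle_nonneg _ _, angle_le_pi _ _⟩, cos_angle, cos_angle,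
    div_eq_div_iff (by positivity) (by positivity), ← sub_eq_zero, hfactor,
    mul_eq_zero_iff_left (mul_ne_zero (norm_ne_zero_iff.2 hab) hinner), sub_eq_zero]

theorem isBisectorFoot_iff {A B C P : ℂ} (hABC : ¬ Collinear ℝ {A, B, C}) :
    IsBisectorFoot A B C P ↔
      P = (dist C A / (dist C A + dist A B)) • B + (dist A B / (dist C A + dist A B)) • C := by
  have hBA : B - A ≠ 0 := sub_ne_zero.2 (ne₁₂_of_not_collinear hABC).symm
  have hCA : C - A ≠ 0 := sub_ne_zero.2 (ne₁₃_of_not_collinear hABC).symm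
  have hangle : angle (B - A) (C - A) ≠ 0 := fun h =>
    hABC (Set.insert_comm A B {C} ▸ EuclideanGeometry.collinear_of_angle_eq_zero h)
  have hc : 0 < dist A B := dist_pos.2 (ne₁₂_of_not_collinear hABC)
  have hb : 0 < dist C A := dist_pos.2 (ne₁₃_of_not_collinear hABC).symm
  have bisects_iff {s t : ℝ} (hs : 0 ≤ s) (ht : 0 ≤ t) (hst : s + t = 1) :
      ∠ B A (s • B + t • C) = ∠ (s • B + t • C) A C ↔ s * dist A B = t * dist C A := by
    have hsub : s • B + t • C - A = s • (B - A) + t • (C - A) := by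
      rw [← eq_sub_iff_add_eq] at hst
      rw [hst]
      module
    have hne : s • (B - A) + t • (C - A) ≠ 0 := by
      rw [← hsub, sub_ne_zero]
      intro h
      have hA : A ∈ segment ℝ B C := ⟨s, t, hs, ht, hst, h⟩
      exact hABC (Set.insert_comm A B {C} ▸ (mem_segment_iff_wbtw.1 hA).collinear)
    simp only [EuclideanGeometry.angle, vsub_eq_sub, hsub]
    rw [angle_smul_add_smul_eq_iff hBA hCA hangle hne, ← dist_eq_norm, ← dist_eq_norm,
      dist_comm B A]
  constructor
  · rintro ⟨⟨s, t, hs, ht, hst, rfl⟩, hbisects⟩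
    rw [bisects_iff hs ht hst] at hbisects
    obtain rfl := eq_sub_of_add_eq hst
    congr 2 <;> field_simp <;> linarith
  · rintro rfl
    have hsum : dist C A / (dist C A + dist A B) + dist A B / (dist C A + dist A B) = 1 := by
      field_simp
    refine ⟨⟨_, _, by positivity, by positivity, hsum, rfl⟩,
      (bisects_iff (by positivity) (by positivity) hsum).2 ?_⟩
    ring

theorem norm_smul_add_smul_sq {V : Type*} [NormedAddCommGroup V] [InnerProductSpace ℝ V]
    (a b : ℝ) (x y : V) :
    ‖a • x + b • y‖ ^ 2 =
      a ^ 2 * ‖x‖ ^ 2 + a * b * (‖x‖ ^ 2 + ‖y‖ ^ 2 - ‖y - x‖ ^ 2) + b ^ 2 * ‖y‖ ^ 2 := by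
  rw [norm_add_sq_real, norm_sub_sq_real, real_inner_smul_left, real_inner_smul_right, norm_smul,
    norm_smul, mul_pow, mul_pow, Real.norm_eq_abs, Real.norm_eq_abs, sq_abs, sq_abs,
    real_inner_comm x y]
  ring

end AngleBisector

section BisectralTriangle

theorem not_collinear_rotate {k V P : Type*} [DivisionRing k] [AddCommGroup V] [Module k V]
    [AddTorsor V P] {A B C : P} (h : ¬ Collinear k {A, B, C}) : ¬ Collinear k {B, C, A} := by
  rwa [Set.insert_comm, Set.pair_comm A C] at h

theorem not_collinear_points {k V P : Type*} [DivisionRing k] [AddCommGroup V] [Module k V]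
    [AddTorsor V P] (T : Affine.Triangle k P) {i j l : Fin 3} (hij : i ≠ j) (hil : i ≠ l)
    (hjl : j ≠ l) : ¬ Collinear k {T.points i, T.points j, T.points l} :=
  (affineIndependent_iff_not_collinear_of_ne hij hil hjl).1 T.independent

theorem norm_sq_sub_norm_sq_eq_mul_cubic {V : Type*} [NormedAddCommGroup V]
    [InnerProductSpace ℝ V] {x y : V} {a b c : ℝ} (ha : 0 < a) (hb : 0 < b) (hc : 0 < c)
    (hx : ‖x‖ = c) (hy : ‖y‖ = b) (hxy : ‖y - x‖ = a) :
    ‖(b / (a + b) - b / (b + c)) • x + (-(c / (b + c))) • y‖ ^ 2 -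
        ‖(b / (a + b)) • x + (-(c / (c + a))) • y‖ ^ 2 =
      (b - a) * (a * b * c * (a + b) / ((a + b) ^ 2 * (b + c) ^ 2 * (c + a) ^ 2)) *
        ((a + b + c) * (a ^ 2 + b ^ 2 - c ^ 2) + a * b * c) := by
  rw [norm_smul_add_smul_sq, norm_smul_add_smul_sq, hx, hy, hxy]
  field_simp
  ring

theorem dist_bisectorFoot_eq_iff {A B C A₁ B₁ C₁ : ℂ} (hABC : ¬ Collinear ℝ {A, B, C})
    (hA₁ : IsBisectorFoot A B C A₁) (hB₁ : IsBisectorFoot B C A B₁) (hC₁ : IsBisectorFoot C A B C₁)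
    (hne : dist B C ≠ dist C A) :
    dist C₁ A₁ = dist C₁ B₁ ↔
      (dist B C + dist C A + dist A B) * (dist B C ^ 2 + dist C A ^ 2 - dist A B ^ 2) +
        dist B C * dist C A * dist A B = 0 := by
  have hBCA := not_collinear_rotate hABC
  have hCAB := not_collinear_rotate hBCA
  rw [isBisectorFoot_iff hABC] at hA₁
  rw [isBisectorFoot_iff hBCA] at hB₁
  rw [isBisectorFoot_iff hCAB] at hC₁
  have hc : 0 < dist A B := dist_pos.2 (ne₁₂_of_not_collinear hABC)
  have ha : 0 < dist B C := dist_pos.2 (ne₁₂_of_not_collinear hBCA)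
  have hb : 0 < dist C A := dist_pos.2 (ne₁₂_of_not_collinear hCAB)
  have hBA : ‖B - A‖ = dist A B := by rw [dist_comm, dist_eq_norm]
  have hCA : ‖C - A‖ = dist C A := by rw [dist_eq_norm]
  have hCB : ‖C - A - (B - A)‖ = dist B C := by
    rw [dist_comm, dist_eq_norm, sub_sub_sub_cancel_right]
  set c := dist A B
  set a := dist B C
  set b := dist C A
  have hCA₁ : C₁ - A₁ = (b / (a + b) - b / (b + c)) • (B - A) + (-(c / (b + c))) • (C - A) := by
    have h₁ : a / (a + b) = 1 - b / (a + b) := by field_simp; ring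
    have h₂ : b / (b + c) = 1 - c / (b + c) := by field_simp; ring
    rw [hA₁, hC₁, h₁, h₂]
    module
  have hCB₁ : C₁ - B₁ = (b / (a + b)) • (B - A) + (-(c / (c + a))) • (C - A) := by
    have h₁ : a / (a + b) = 1 - b / (a + b) := by field_simp; ring
    have h₂ : a / (c + a) = 1 - c / (c + a) := by field_simp; ring
    rw [hB₁, hC₁, h₁, h₂]
    module
  rw [dist_eq_norm, dist_eq_norm, ← sq_eq_sq₀ (norm_nonneg _) (norm_nonneg _), ← sub_eq_zero,
    hCA₁, hCB₁, norm_sq_sub_norm_sq_eq_mul_cubic ha hb hc hBA hCA hCB, mul_eq_zero_iff_left]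
  exact mul_ne_zero (sub_ne_zero.2 hne.symm) (by positivity)

theorem cubic_dist_eq_zero_iff {V P : Type*} [NormedAddCommGroup V] [InnerProductSpace ℝ V]
    [MetricSpace P] [NormedAddTorsor V P] {A B C : P} (hABC : ¬ Collinear ℝ {A, B, C}) :
    (dist B C + dist C A + dist A B) * (dist B C ^ 2 + dist C A ^ 2 - dist A B ^ 2) +
        dist B C * dist C A * dist A B = 0 ↔
      2 * Real.cos (∠ B C A) * (Real.sin (∠ C A B) + Real.sin (∠ A B C) + Real.sin (∠ B C A)) +
        Real.sin (∠ B C A) = 0 := by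
  have hBCA := not_collinear_rotate hABC
  have hCAB := not_collinear_rotate hBCA
  have hb : 0 < dist C A := dist_pos.2 (ne₁₂_of_not_collinear hCAB)
  have ha : 0 < dist B C := dist_pos.2 (ne₁₂_of_not_collinear hBCA)
  have hcos := EuclideanGeometry.law_cos B C A
  have hsinB := EuclideanGeometry.law_sin A B C
  have hsinC := EuclideanGeometry.law_sin C A B
  have hsinA := EuclideanGeometry.sin_pos_of_not_collinear hCAB
  rw [dist_comm B A, dist_comm A C] at hcos
  have hscale : Real.sin (∠ C A B) *
      ((dist B C + dist C A + dist A B) * (dist B C ^ 2 + dist C A ^ 2 - dist A B ^ 2) +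
        dist B C * dist C A * dist A B) =
      dist B C ^ 2 * dist C A *
        (2 * Real.cos (∠ B C A) * (Real.sin (∠ C A B) + Real.sin (∠ A B C) + Real.sin (∠ B C A)) +
          Real.sin (∠ B C A)) := by
    rw [show dist B C ^ 2 + dist C A ^ 2 - dist A B ^ 2 =
      2 * dist B C * dist C A * Real.cos (∠ B C A) by linarith]
    linear_combination
      (-2 * dist B C * dist C A * Real.cos (∠ B C A)) * hsinB +
        (2 * dist B C * dist C A * Real.cos (∠ B C A) + dist B C * dist C A) * hsinC
  rw [← mul_eq_zero_iff_left hsinA.ne', hscale, mul_eq_zero_iff_left (by positivity)]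

theorem dist_bisectorFoot_eq_iff_angle {A B C A₁ B₁ C₁ : ℂ} (hABC : ¬ Collinear ℝ {A, B, C})
    (hA₁ : IsBisectorFoot A B C A₁) (hB₁ : IsBisectorFoot B C A B₁) (hC₁ : IsBisectorFoot C A B C₁)
    (hne : dist B C ≠ dist C A) :
    dist C₁ A₁ = dist C₁ B₁ ↔
      2 * Real.cos (∠ B C A) * (Real.sin (∠ C A B) + Real.sin (∠ A B C) + Real.sin (∠ B C A)) +
        Real.sin (∠ B C A) = 0 :=
  (dist_bisectorFoot_eq_iff hABC hA₁ hB₁ hC₁ hne).trans (cubic_dist_eq_zero_iff hABC)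

end BisectralTriangle

section InscribedTriangle

variable {r : ℝ} {o w : ℂ} {V : Set ℂ} {T : Affine.Triangle ℝ ℂ}

theorem exp_two_mul_sub_exp_two_mul (α β : ℝ) :
    Complex.exp (2 * β * Complex.I) - Complex.exp (2 * α * Complex.I) =
      (2 * Real.sin (β - α)) •
        (Complex.I * Complex.exp (α * Complex.I) * Complex.exp (β * Complex.I)) := by
  have hβ : Complex.exp ((β - α) * Complex.I) *
      (Complex.exp (α * Complex.I) * Complex.exp (β * Complex.I)) =
      Complex.exp (2 * β * Complex.I) := by
    rw [← Complex.exp_add, ← Complex.exp_add]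
    ring_nf
  have hα : Complex.exp (-(β - α) * Complex.I) *
      (Complex.exp (α * Complex.I) * Complex.exp (β * Complex.I)) =
      Complex.exp (2 * α * Complex.I) := by
    rw [← Complex.exp_add, ← Complex.exp_add]
    ring_nf
  rw [Complex.real_smul]
  push_cast
  rw [Complex.two_sin, ← hβ, ← hα]
  linear_combination (Complex.exp ((β - α) * Complex.I) - Complex.exp (-(β - α) * Complex.I)) *
    (Complex.exp (α * Complex.I) * Complex.exp (β * Complex.I)) * Complex.I_sq

theorem inscribed_angle_eq_abs_sub (hw : w ≠ 0) {α β γ : ℝ} (hβ : β ∈ Set.Ioo α (α + π))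
    (hγ : γ ∈ Set.Ioo α (α + π)) :
    ∠ (o + w * Complex.exp (2 * β * Complex.I)) (o + w * Complex.exp (2 * α * Complex.I))
      (o + w * Complex.exp (2 * γ * Complex.I)) = |β - γ| := by
  have hsin {δ : ℝ} (hδ : δ ∈ Set.Ioo α (α + π)) : 0 < 2 * Real.sin (δ - α) :=
    mul_pos two_pos (Real.sin_pos_of_mem_Ioo ⟨sub_pos.2 hδ.1, sub_lt_iff_lt_add'.2 hδ.2⟩)
  have hI : Complex.I * Complex.exp (α * Complex.I) ≠ 0 :=
    mul_ne_zero Complex.I_ne_zero (Complex.exp_ne_zero _)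
  simp only [EuclideanGeometry.angle, vsub_eq_sub, add_sub_add_left_eq_sub, ← mul_sub]
  rw [Complex.angle_mul_left hw, exp_two_mul_sub_exp_two_mul, exp_two_mul_sub_exp_two_mul,
    InnerProductGeometry.angle_smul_left_of_pos _ _ (hsin hβ),
    InnerProductGeometry.angle_smul_right_of_pos _ _ (hsin hγ), Complex.angle_mul_left hI,
    Complex.angle_exp_exp, (toIocMod_eq_self _).2]
  constructor <;> linarith [hβ.1, hβ.2, hγ.1, hγ.2]

/-- The vertices `o + w * exp (2πik/n)` of the regular `n`-gon with center `o` and one vertex at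
`o + w`. The indices `k` are integers, so that any two vertices other than a third one can be given
indices within `n` after the index of the latter. -/
noncomputable def polygonVertex (n : ℕ) (o w : ℂ) (k : ℤ) : ℂ :=
  o + w * Complex.exp (2 * (k * (π / n) : ℝ) * Complex.I)

theorem polygonVertex_natCast (n : ℕ) (o w : ℂ) (k : ℕ) :
    polygonVertex n o w k = o + w * Complex.exp (2 * (π : ℂ) * Complex.I * (k : ℂ) / (n : ℂ)) := by
  rw [polygonVertex]
  push_cast
  ring_nf

theorem polygonVertex_add_self {n : ℕ} (hn : n ≠ 0) (o w : ℂ) (k : ℤ) :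
    polygonVertex n o w (k + n) = polygonVertex n o w k := by
  rw [polygonVertex, polygonVertex, ← Complex.exp_periodic (2 * (k * (π / n) : ℝ) * Complex.I)]
  push_cast
  field_simp

theorem dist_polygonVertex_center (n : ℕ) (o w : ℂ) (k : ℤ) :
    dist (polygonVertex n o w k) o = ‖w‖ := by
  have hunit : ‖Complex.exp (2 * (k * (π / n) : ℝ) * Complex.I)‖ = 1 := by
    rw [← Complex.ofReal_ofNat, ← Complex.ofReal_mul, Complex.norm_exp_ofReal_mul_I]
  rw [polygonVertex, dist_eq_norm, add_sub_cancel_left, norm_mul, hunit, mul_one]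

theorem angle_polygonVertex (hw : w ≠ 0) {n : ℕ} {i j k : ℤ} (hi : i ∈ Set.Ioo j (j + n))
    (hk : k ∈ Set.Ioo j (j + n)) :
    ∠ (polygonVertex n o w i) (polygonVertex n o w j) (polygonVertex n o w k) =
      |(i - k : ℝ)| * (π / n) := by
  have hn : (0 : ℝ) < n := by exact_mod_cast (by linarith [hi.1, hi.2] : (0 : ℤ) < n)
  have hIoo {l : ℤ} (hl : l ∈ Set.Ioo j (j + n)) :
      l * (π / n) ∈ Set.Ioo (j * (π / n)) (j * (π / n) + π) := by
    have hlt : (j : ℝ) < l := by exact_mod_cast hl.1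
    have hlt' : (l : ℝ) < j + n := by exact_mod_cast hl.2
    have hπ : j * (π / n) + π = (j + n) * (π / n) := by field_simp
    exact ⟨by gcongr, hπ ▸ by gcongr⟩
  simp only [polygonVertex]
  rw [inscribed_angle_eq_abs_sub hw (hIoo hi) (hIoo hk), ← sub_mul, abs_mul,
    abs_of_pos (show 0 < π / n by positivity)]

theorem exists_mem_Ioo_polygonVertex_eq (o w : ℂ) {n : ℕ} {i j : Fin n} (hij : i ≠ j) :
    ∃ k ∈ Set.Ioo (j : ℤ) (j + n), polygonVertex n o w k = polygonVertex n o w i := by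
  rcases hij.lt_or_gt with hlt | hlt
  · exact ⟨i + n, ⟨by omega, by omega⟩, polygonVertex_add_self (by omega) o w i⟩
  · exact ⟨i, ⟨by omega, by omega⟩, rfl⟩

theorem isRegularPolygonVertexSet_iff :
    IsRegularPolygonVertexSet r V ↔ 0 < r ∧ ∃ (n : ℕ) (o w : ℂ), 3 ≤ n ∧ ‖w‖ = r ∧
      V = Set.range fun k : Fin n => polygonVertex n o w k := by
  simp only [IsRegularPolygonVertexSet, polygonVertex_natCast]

theorem IsRegularPolygonVertexSet.exists_angle_eq_rat_mul_pi (hV : IsRegularPolygonVertexSet r V)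
    {x y z : ℂ} (hx : x ∈ V) (hy : y ∈ V) (hz : z ∈ V) (hyx : y ≠ x) (hzx : z ≠ x) :
    ∃ q : ℚ, ∠ y x z = q * π := by
  obtain ⟨hr, n, o, w, -, hwr, rfl⟩ := isRegularPolygonVertexSet_iff.1 hV
  obtain ⟨i, rfl⟩ := hx
  obtain ⟨j, rfl⟩ := hy
  obtain ⟨k, rfl⟩ := hz
  have hw : w ≠ 0 := norm_pos_iff.1 (hwr ▸ hr)
  obtain ⟨j', hj', hj⟩ := exists_mem_Ioo_polygonVertex_eq o w (fun h : j = i => hyx (h ▸ rfl))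
  obtain ⟨k', hk', hk⟩ := exists_mem_Ioo_polygonVertex_eq o w (fun h : k = i => hzx (h ▸ rfl))
  refine ⟨|j' - k'| / n, ?_⟩
  beta_reduce
  rw [← hj, ← hk, angle_polygonVertex hw hj' hk']
  push_cast
  ring

theorem HasVerticesInRegularPolygon.exists_angle_eq_rat_mul_pi
    (hT : HasVerticesInRegularPolygon r T) {i j k : Fin 3} (hij : i ≠ j) (hkj : k ≠ j) :
    ∃ q : ℚ, ∠ (T.points i) (T.points j) (T.points k) = q * π := by
  obtain ⟨V, hV, hTV⟩ := hT
  exact hV.exists_angle_eq_rat_mul_pi (hTV ⟨j, rfl⟩) (hTV ⟨i, rfl⟩) (hTV ⟨k, rfl⟩)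
    (T.independent.injective.ne hij) (T.independent.injective.ne hkj)

theorem affineSpan_range_points_eq_top (T : Affine.Triangle ℝ ℂ) :
    affineSpan ℝ (Set.range T.points) = ⊤ :=
  T.independent.affineSpan_eq_top_iff_card_eq_finrank_add_one.2
    (by simp [Complex.finrank_real_complex])

theorem HasVerticesInRegularPolygon.circumradius_eq (hT : HasVerticesInRegularPolygon r T) :
    T.circumradius = r := by
  obtain ⟨V, hV, hTV⟩ := hT
  obtain ⟨-, n, o, w, -, hwr, rfl⟩ := isRegularPolygonVertexSet_iff.1 hV
  have ho : o ∈ affineSpan ℝ (Set.range T.points) :=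
    affineSpan_range_points_eq_top T ▸ AffineSubspace.mem_top ℝ ℂ o
  refine (T.eq_circumradius_of_dist_eq ho fun i => ?_).symm
  obtain ⟨k, hk⟩ := hTV ⟨i, rfl⟩
  rw [← hk, ← hwr]
  exact dist_polygonVertex_center n o w k

theorem HasVerticesInRegularPolygon.reindex (hT : HasVerticesInRegularPolygon r T)
    (σ : Equiv.Perm (Fin 3)) : HasVerticesInRegularPolygon r (T.reindex σ) := by
  obtain ⟨V, hV, hTV⟩ := hT
  exact ⟨V, hV, by rwa [Affine.Simplex.reindex_range_points]⟩

end InscribedTriangle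

section Congruence

variable {V V' P P' : Type*} [NormedAddCommGroup V] [InnerProductSpace ℝ V] [MetricSpace P]
  [NormedAddTorsor V P] [NormedAddCommGroup V'] [InnerProductSpace ℝ V'] [MetricSpace P']
  [NormedAddTorsor V' P']

theorem congruent_of_similar_of_circumradius_eq {T : Affine.Triangle ℝ P}
    {S : Affine.Triangle ℝ P'} (h : Similar T.points S.points)
    (hR : T.circumradius = S.circumradius) : Congruent T.points S.points := by
  have hangle : ∠ (T.points 0) (T.points 1) (T.points 2) =
      ∠ (S.points 0) (S.points 1) (S.points 2) := by
    rw [← FinVec.etaExpand_eq T.points, ← FinVec.etaExpand_eq S.points] at h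
    exact h.angle_eq
  have hsin : Real.sin (∠ (T.points 0) (T.points 1) (T.points 2)) ≠ 0 :=
    (EuclideanGeometry.sin_pos_of_not_collinear
      (not_collinear_points T (by decide) (by decide) (by decide))).ne'
  have hside : dist (T.points 0) (T.points 2) = dist (S.points 0) (S.points 2) := by
    have hT := T.dist_div_sin_angle_eq_two_mul_circumradius
      (i₁ := 0) (i₂ := 1) (i₃ := 2) (by decide) (by decide) (by decide)
    have hS := S.dist_div_sin_angle_eq_two_mul_circumradius
      (i₁ := 0) (i₂ := 1) (i₃ := 2) (by decide) (by decide) (by decide)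
    rwa [hR, ← hS, ← hangle, div_left_inj' hsin] at hT
  obtain ⟨ρ, -, hρ⟩ := similar_iff_exists_pos_dist_eq.1 h
  have hρ₁ : ρ = 1 := by
    have hpos : dist (S.points 0) (S.points 2) ≠ 0 :=
      dist_ne_zero.2 (S.independent.injective.ne (by decide))
    exact mul_right_cancel₀ hpos (by rw [← hρ, hside, one_mul])
  exact congruent_iff_dist_eq.2 fun i j => by rw [hρ, hρ₁, one_mul]

theorem exists_isometryEquiv_of_congruent {ι : Type*} [Finite ι] (b : AffineBasis ι ℝ P)
    (b' : AffineBasis ι ℝ P') (h : Congruent b b') : ∃ e : P ≃ᵢ P', ∀ i, e (b i) = b' i := by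
  have := Fintype.ofFinite ι
  let f (x : P) : P' := Finset.univ.affineCombination ℝ b' fun i => b.coord i x
  let g (y : P') : P := Finset.univ.affineCombination ℝ b fun i => b'.coord i y
  have isometry_f : Isometry f := Isometry.of_dist_eq fun x y => by
    have hf := EuclideanGeometry.dist_affineCombination b'
      (b.sum_coord_apply_eq_one x) (b.sum_coord_apply_eq_one y)
    have hid := EuclideanGeometry.dist_affineCombination b
      (b.sum_coord_apply_eq_one x) (b.sum_coord_apply_eq_one y)
    simp only [b.affineCombination_coord_eq_self, h.dist_eq] at hid
    exact (mul_self_inj_of_nonneg dist_nonneg dist_nonneg).1 (hf.trans hid.symm)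
  have f_g (y : P') : f (g y) = y := by
    have hcoord (i : ι) : b.coord i (g y) = b'.coord i y :=
      b.coord_apply_combination_of_mem (Finset.mem_univ i) (b'.sum_coord_apply_eq_one y)
    simp only [f, hcoord, b'.affineCombination_coord_eq_self]
  refine ⟨IsometryEquiv.mk' f g f_g isometry_f, fun i => ?_⟩
  have hg : g (b' i) = b i := by
    refine b.ext_elem fun j => ?_
    rw [b.coord_apply_combination_of_mem (Finset.mem_univ j) (b'.sum_coord_apply_eq_one (b' i))]
    classical rw [b.coord_apply, b'.coord_apply]
  exact hg ▸ f_g (b' i)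

end Congruence

section HeptagonalTriangle

variable {S T : Affine.Triangle ℝ ℂ}

theorem angles_eq_of_dist_bisectorFoot_eq {A B C A₁ B₁ C₁ : ℂ} (hABC : ¬ Collinear ℝ {A, B, C})
    (hA : ∃ q : ℚ, ∠ C A B = q * π) (hB : ∃ q : ℚ, ∠ A B C = q * π)
    (hA₁ : IsBisectorFoot A B C A₁) (hB₁ : IsBisectorFoot B C A B₁) (hC₁ : IsBisectorFoot C A B C₁)
    (hne : dist C A ≠ dist C B) (h : dist C₁ A₁ = dist C₁ B₁) :
    ∠ B C A = 4 * π / 7 ∧ ((∠ C A B = π / 7 ∧ ∠ A B C = 2 * π / 7) ∨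
      (∠ C A B = 2 * π / 7 ∧ ∠ A B C = π / 7)) := by
  have hBCA := not_collinear_rotate hABC
  have hCAB := not_collinear_rotate hBCA
  have hsum := EuclideanGeometry.angle_add_angle_add_angle_eq_pi C (ne₁₂_of_not_collinear hABC).symm
  have hangles : ∠ C A B ≠ ∠ A B C := fun heq => hne <|
    EuclideanGeometry.dist_eq_of_angle_eq_angle_of_angle_ne_pi
      (heq.trans (EuclideanGeometry.angle_comm A B C)) fun hpi =>
      hBCA (EuclideanGeometry.collinear_of_angle_eq_pi (EuclideanGeometry.angle_comm A C B ▸ hpi))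
  exact angles_eq_of_rational (EuclideanGeometry.angle_pos_of_not_collinear hCAB)
    (EuclideanGeometry.angle_pos_of_not_collinear hABC)
    (EuclideanGeometry.angle_pos_of_not_collinear hBCA) (by linarith) hangles
    ((dist_bisectorFoot_eq_iff_angle hABC hA₁ hB₁ hC₁ (dist_comm C B ▸ hne.symm)).1 h) hA hB

theorem exists_perm_symm_apply_eq :
    ∀ {i j k : Fin 3}, i ≠ j → i ≠ k → j ≠ k →
      ∃ σ : Equiv.Perm (Fin 3), σ.symm 0 = i ∧ σ.symm 1 = j ∧ σ.symm 2 = k := by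
  decide

theorem exists_isHeptagonal_reindex_of_angles {i j k : Fin 3} (hij : i ≠ j) (hik : i ≠ k)
    (hjk : j ≠ k) (hi : ∠ (T.points k) (T.points i) (T.points j) = π / 7)
    (hj : ∠ (T.points i) (T.points j) (T.points k) = 2 * π / 7)
    (hk : ∠ (T.points j) (T.points k) (T.points i) = 4 * π / 7) :
    ∃ σ : Equiv.Perm (Fin 3), IsHeptagonal (T.reindex σ) := by
  obtain ⟨σ, rfl, rfl, rfl⟩ := exists_perm_symm_apply_eq hij hik hjk
  exact ⟨σ, hi, hj, hk⟩

theorem IsSharygin.exists_isHeptagonal_reindex (hT : IsSharygin T)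
    (hangle : ∀ {i j k : Fin 3}, i ≠ j → k ≠ j →
      ∃ q : ℚ, ∠ (T.points i) (T.points j) (T.points k) = q * π) :
    ∃ σ : Equiv.Perm (Fin 3), IsHeptagonal (T.reindex σ) := by
  have reindex {i j k : Fin 3} (hij : i ≠ j) (hik : i ≠ k) (hjk : j ≠ k) {P Q R : ℂ}
      (hP : IsBisectorFoot (T.points i) (T.points j) (T.points k) P)
      (hQ : IsBisectorFoot (T.points j) (T.points k) (T.points i) Q)
      (hR : IsBisectorFoot (T.points k) (T.points i) (T.points j) R)
      (hne : dist (T.points k) (T.points i) ≠ dist (T.points k) (T.points j))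
      (h : dist R P = dist R Q) : ∃ σ : Equiv.Perm (Fin 3), IsHeptagonal (T.reindex σ) := by
    obtain ⟨hk, ⟨hi, hj⟩ | ⟨hi, hj⟩⟩ := angles_eq_of_dist_bisectorFoot_eq
      (not_collinear_points T hij hik hjk) (hangle hik.symm hij.symm) (hangle hij hjk.symm)
      hP hQ hR hne h
    · exact exists_isHeptagonal_reindex_of_angles hij hik hjk hi hj hk
    · rw [EuclideanGeometry.angle_comm] at hi hj hk
      exact exists_isHeptagonal_reindex_of_angles hij.symm hjk hik hj hi hk
  obtain ⟨hscalene, A₁, B₁, C₁, hA₁, hB₁, hC₁, hisosceles⟩ := hT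
  simp only [IsIsosceles, not_or] at hscalene
  obtain ⟨hA, hB, hC⟩ := hscalene
  rcases hisosceles with h | h | h
  · exact reindex (by decide) (by decide) (by decide) hB₁ hC₁ hA₁ hA h
  · exact reindex (by decide) (by decide) (by decide) hC₁ hA₁ hB₁ (Ne.symm hB) h.symm
  · exact reindex (by decide) (by decide) (by decide) hA₁ hB₁ hC₁ hC h

theorem IsHeptagonal.similar (hT : IsHeptagonal T) (hS : IsHeptagonal S) :
    Similar T.points S.points := by
  rw [← FinVec.etaExpand_eq T.points, ← FinVec.etaExpand_eq S.points]
  exact EuclideanGeometry.similar_of_angle_angle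
    (not_collinear_points T (by decide) (by decide) (by decide))
    (hT.2.1.trans hS.2.1.symm) (hT.2.2.trans hS.2.2.symm)

theorem IsHeptagonal.not_isIsosceles (hT : IsHeptagonal T) :
    ¬ IsIsosceles (T.points 0) (T.points 1) (T.points 2) := by
  obtain ⟨h₀, h₁, h₂⟩ := hT
  rintro (h | h | h) <;> have hangle := EuclideanGeometry.angle_eq_angle_of_dist_eq h
  · rw [h₁, EuclideanGeometry.angle_comm, h₂] at hangle
    linarith [Real.pi_pos]
  · rw [EuclideanGeometry.angle_comm, h₀, h₂] at hangle
    linarith [Real.pi_pos]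
  · rw [h₀, EuclideanGeometry.angle_comm, h₁] at hangle
    linarith [Real.pi_pos]

theorem two_mul_cos_four_pi_div_seven_mul_add_sin_eq_zero :
    2 * Real.cos (4 * π / 7) *
        (Real.sin (π / 7) + Real.sin (2 * π / 7) + Real.sin (4 * π / 7)) +
      Real.sin (4 * π / 7) = 0 := by
  rw [two_mul_cos_mul_add_sin_eq (by ring)]
  have h₁ : 2 * ((π / 7 + 2 * π / 7) / 2) - (π / 7 - 2 * π / 7) / 2 = π / 2 := by ring
  have h₂ : 3 * ((π / 7 + 2 * π / 7) / 2) =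
      π - (2 * ((π / 7 + 2 * π / 7) / 2) + (π / 7 - 2 * π / 7) / 2) := by ring
  rw [h₁, h₂, Real.cos_pi_sub, Real.cos_pi_div_two]
  ring

theorem IsHeptagonal.isSharygin (hT : IsHeptagonal T) : IsSharygin T := by
  have hABC := not_collinear_points T (i := 0) (j := 1) (l := 2) (by decide) (by decide) (by decide)
  have hBCA := not_collinear_rotate hABC
  have hA₁ := (isBisectorFoot_iff hABC).2 rfl
  have hB₁ := (isBisectorFoot_iff hBCA).2 rfl
  have hC₁ := (isBisectorFoot_iff (not_collinear_rotate hBCA)).2 rfl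
  have hne : dist (T.points 1) (T.points 2) ≠ dist (T.points 2) (T.points 0) := fun h =>
    hT.not_isIsosceles (Or.inr (Or.inr (by rw [← h, dist_comm])))
  refine ⟨hT.not_isIsosceles, _, _, _, hA₁, hB₁, hC₁, Or.inr (Or.inr ?_)⟩
  rw [dist_bisectorFoot_eq_iff_angle hABC hA₁ hB₁ hC₁ hne, hT.1, hT.2.1, hT.2.2]
  exact two_mul_cos_four_pi_div_seven_mul_add_sin_eq_zero

theorem exists_isHeptagonal_hasVerticesInRegularPolygon {r : ℝ} (hr : 0 < r) :
    ∃ T : Affine.Triangle ℝ ℂ, IsHeptagonal T ∧ HasVerticesInRegularPolygon r T := by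
  have hπ := Real.pi_pos
  let vertex (k : ℤ) : ℂ := polygonVertex 7 0 r k
  have vertex_add_seven (k : ℤ) : vertex (k + 7) = vertex k :=
    polygonVertex_add_self (by norm_num) 0 r k
  have angle_vertex {i j k : ℤ} (hi : i ∈ Set.Ioo j (j + 7)) (hk : k ∈ Set.Ioo j (j + 7)) :
      ∠ (vertex i) (vertex j) (vertex k) = |(i - k : ℝ)| * (π / 7) :=
    angle_polygonVertex (Complex.ofReal_ne_zero.2 hr.ne') hi hk
  have angle₀ : ∠ (vertex 1) (vertex 3) (vertex 0) = π / 7 := by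
    rw [← vertex_add_seven 1, ← vertex_add_seven 0, angle_vertex (by norm_num) (by norm_num)]
    norm_num
  have angle₁ : ∠ (vertex 3) (vertex 0) (vertex 1) = 2 * π / 7 := by
    rw [angle_vertex (by norm_num) (by norm_num)]
    norm_num
    ring
  have angle₂ : ∠ (vertex 0) (vertex 1) (vertex 3) = 4 * π / 7 := by
    rw [← vertex_add_seven 0, angle_vertex (by norm_num) (by norm_num)]
    norm_num
    ring
  have hncol : ¬ Collinear ℝ {vertex 3, vertex 0, vertex 1} := by
    rw [EuclideanGeometry.collinear_iff_eq_or_eq_or_angle_eq_zero_or_angle_eq_pi]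
    rintro (h | h | h | h)
    · rw [h, EuclideanGeometry.angle_self_left] at angle₁
      linarith
    · rw [h, EuclideanGeometry.angle_self_right] at angle₁
      linarith
    · linarith
    · linarith
  refine ⟨⟨![vertex 3, vertex 0, vertex 1], affineIndependent_iff_not_collinear_set.2 hncol⟩,
    ⟨angle₀, angle₁, angle₂⟩, _, isRegularPolygonVertexSet_iff.2
      ⟨hr, 7, 0, r, by norm_num, Complex.norm_of_nonneg hr.le, rfl⟩, ?_⟩
  rintro _ ⟨i, rfl⟩
  fin_cases i
  exacts [⟨3, rfl⟩, ⟨0, rfl⟩, ⟨1, rfl⟩]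

theorem IsHeptagonal.exists_isometryEquiv (hT : IsHeptagonal T) (hS : IsHeptagonal S)
    (hR : T.circumradius = S.circumradius) :
    ∃ e : ℂ ≃ᵢ ℂ, e '' Set.range T.points = Set.range S.points := by
  obtain ⟨e, he⟩ := exists_isometryEquiv_of_congruent
    ⟨T.points, T.independent, affineSpan_range_points_eq_top T⟩
    ⟨S.points, S.independent, affineSpan_range_points_eq_top S⟩
    (congruent_of_similar_of_circumradius_eq (hT.similar hS) hR)
  exact ⟨e, by rw [← Set.range_comp]; exact congrArg Set.range (funext he)⟩

end HeptagonalTriangle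

theorem mainTheorem2 :
    -- a Sharygin triangle with vertices in a regular polygon has angles `π/7`, `2π/7`, `4π/7`
    -- after relabelling, and is similar to every triangle with these angles
    (∀ (T : Affine.Triangle ℝ ℂ) (r : ℝ), IsSharygin T → HasVerticesInRegularPolygon r T →
      (∃ σ : Equiv.Perm (Fin 3), IsHeptagonal (T.reindex σ)) ∧
      ∀ H : Affine.Triangle ℝ ℂ, IsHeptagonal H →
        ∃ σ : Equiv.Perm (Fin 3), Similar (T.reindex σ).points H.points) ∧
    -- for circumradius one, such a triangle exists and is unique up to an isometry of the plane
    (∃ T₀ : Affine.Triangle ℝ ℂ, IsSharygin T₀ ∧ HasVerticesInRegularPolygon 1 T₀ ∧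
      ∀ T : Affine.Triangle ℝ ℂ, IsSharygin T → HasVerticesInRegularPolygon 1 T →
        ∃ e : ℂ ≃ᵢ ℂ, e '' Set.range T.points = Set.range T₀.points) := by
  refine ⟨fun T r hT hr => ?_, ?_⟩
  · obtain ⟨σ, hσ⟩ := hT.exists_isHeptagonal_reindex hr.exists_angle_eq_rat_mul_pi
    exact ⟨⟨σ, hσ⟩, fun H hH => ⟨σ, hσ.similar hH⟩⟩
  · obtain ⟨T₀, hT₀, hr₀⟩ := exists_isHeptagonal_hasVerticesInRegularPolygon one_pos
    refine ⟨T₀, hT₀.isSharygin, hr₀, fun T hT hr => ?_⟩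
    obtain ⟨σ, hσ⟩ := hT.exists_isHeptagonal_reindex hr.exists_angle_eq_rat_mul_pi
    rw [← Affine.Simplex.reindex_range_points T σ]
    exact hσ.exists_isometryEquiv hT₀
      ((hr.reindex σ).circumradius_eq.trans hr₀.circumradius_eq.symm)
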